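/- Let $q:\mathbb R\to\mathbb R$ be locally integrable with $q\ge 0$ almost everywhere, and assume $$\int_{-\infty}^x q(t)\,dt>0\quad\text{and}\quad\int_x^\infty q(t)\,dt>0\qquad\text{for all }x\in\mathbb R$$ (the value $\infty$ is allowed). Let $\mu,\theta:\mathbb R\to(0,\infty)$ be continuous with $$\int_{-\infty}^0\mu(t)\,dt=\int_0^\infty\mu(t)\,dt=\infty,$$ and let $p\in[1,\infty)$. For a positive continuous weight $w$ put $L_{p,w}=\{f\in L_p^{\rm loc}(\mathbb R):\ \|f\|_{p,w}:=\left(\int_{-\infty}^\infty|w(x)f(x)|^p\,dx\right)^{1/p}<\infty\}$. A solution of $-y''+qy=f$ on $\mathbb R$ is a differentiable function $y$ such that $y$ and $y'$ are absolutely continuous on every compact interval and the equation holds almost everywhere. The pair $\{L_{p,\mu},L_{p,\theta}\}$ is called admissible for $-y''+qy=f$ if (I) for every $f\in L_{p,\theta}$ there is a unique solution $y\in L_{p,\mu}$, and (II) there is a constant $c\in(0,\infty)$ such that $\|y\|_{p,\mu}\le c\,\|f\|_{p,\theta}$ for every $f\in L_{p,\theta}$ and the corresponding solution $y\in L_{p,\mu}$.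 Then the equation $z''=qz$ has solutions $u,v$ on $\mathbb R$ such that $u>0$, $v>0$, $u'<0$, $v'>0$, $v'u-u'v=1$ and $|(uv)'|<1$ everywhere on $\mathbb R$, and $\lim_{x\to-\infty}v(x)/u(x)=\lim_{x\to\infty}u(x)/v(x)=0$. Moreover, for every such pair $\{u,v\}$, with the Green function $$G(x,t)=\begin{cases}u(x)v(t),&x\ge t,\\ u(t)v(x),&x\le t,\end{cases}$$ the pair $\{L_{p,\mu},L_{p,\theta}\}$ is admissible for $-y''+qy=f$ if and only if the operator $$(Sf)(x)=\mu(x)\int_{-\infty}^\infty\frac{G(x,t)}{\theta(t)}f(t)\,dt$$ is bounded from $L_p(\mathbb R)$ to $L_p(\mathbb R)$, that is: for every $f\in L_p(\mathbb R)$ the integral converges absolutely for almost every $x$, $Sf\in L_p(\mathbb R)$, and $\|Sf\|_p\le C\|f\|_p$ with a constant $C$ independent of $f$. -/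

import Mathlib

open MeasureTheory Set Filter Topology
open scoped ENNReal NNReal

noncomputable section

namespace SturmLiouville

/-- `f ∈ L_p^loc(ℝ)`. -/
def MemLpLoc (p : ℝ≥0∞) (f : ℝ → ℝ) : Prop :=
  ∀ K : Set ℝ, IsCompact K → MemLp f p (volume.restrict K)

/-- The weighted norm `‖f‖_{p,w} = (∫ |w f|^p)^{1/p}`, with values in `[0, ∞]`. -/
def weightedNorm (p : ℝ≥0∞) (w f : ℝ → ℝ) : ℝ≥0∞ :=
  eLpNorm (fun x => w x * f x) p volume

/-- `f ∈ L_{p,w}`: `f` is in `L_p^loc(ℝ)` and `‖f‖_{p,w} < ∞`. -/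
def MemWeightedLp (p : ℝ≥0∞) (w f : ℝ → ℝ) : Prop :=
  MemLpLoc p f ∧ weightedNorm p w f < ∞

/-- `y` is a solution of `-y'' + q y = f` on `ℝ`: `y` and `y'` are absolutely continuous on every
compact interval, and the equation holds almost everywhere. -/
structure IsSolution (q f y : ℝ → ℝ) : Prop where
  differentiable : Differentiable ℝ y
  ac : ∀ a b : ℝ, AbsolutelyContinuousOnInterval y a b
  ac_deriv : ∀ a b : ℝ, AbsolutelyContinuousOnInterval (deriv y) a b
  eq_ae : ∀ᵐ x : ℝ, -deriv (deriv y) x + q x * y x = f x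

/-- The pair `{L_{p,μ}, L_{p,θ}}` is admissible for `-y'' + q y = f`. -/
def Admissible (p : ℝ≥0∞) (q μ θ : ℝ → ℝ) : Prop :=
  (∀ f : ℝ → ℝ, MemWeightedLp p θ f →
    ∃! y : ℝ → ℝ, IsSolution q f y ∧ MemWeightedLp p μ y) ∧
  ∃ c : ℝ≥0, 0 < c ∧ ∀ f : ℝ → ℝ, MemWeightedLp p θ f →
    ∀ y : ℝ → ℝ, IsSolution q f y → MemWeightedLp p μ y →
      weightedNorm p μ y ≤ c * weightedNorm p θ f

/-- `{u, v}` is a fundamental system of solutions of `z'' = q z` with `u` positive decreasing,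
`v` positive increasing, Wronskian one, `v / u → 0` at `-∞`, `u / v → 0` at `+∞`, and
`|(u v)'| < 1`. -/
structure IsFSS (q u v : ℝ → ℝ) : Prop where
  sol_u : IsSolution q (fun _ => 0) u
  sol_v : IsSolution q (fun _ => 0) v
  pos_u : ∀ x, 0 < u x
  pos_v : ∀ x, 0 < v x
  deriv_u_neg : ∀ x, deriv u x < 0
  deriv_v_pos : ∀ x, 0 < deriv v x
  wronskian : ∀ x, deriv v x * u x - deriv u x * v x = 1
  tendsto_atBot : Tendsto (fun x => v x / u x) atBot (𝓝 0)
  tendsto_atTop : Tendsto (fun x => u x / v x) atTop (𝓝 0)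
  abs_deriv_mul_lt : ∀ x, |deriv (fun s => u s * v s) x| < 1

/-- The Green function built from `{u, v}`. -/
def green (u v : ℝ → ℝ) (x t : ℝ) : ℝ :=
  if t ≤ x then u x * v t else u t * v x

/-- `(S f)(x) = μ(x) ∫ G(x,t) θ(t)⁻¹ f(t) dt`. -/
def opS (u v μ θ f : ℝ → ℝ) (x : ℝ) : ℝ :=
  μ x * ∫ t, green u v x t / θ t * f t

/-- `S : L_p → L_p` is (well defined and) bounded: for every `f ∈ L_p` the integral defining
`(S f)(x)` converges absolutely for almost every `x`, `S f` is in `L_p`, and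
`‖S f‖_p ≤ C ‖f‖_p` with `C` independent of `f`. -/
def BoundedS (p : ℝ≥0∞) (u v μ θ : ℝ → ℝ) : Prop :=
  ∃ C : ℝ≥0, ∀ f : ℝ → ℝ, MemLp f p volume →
    (∀ᵐ x : ℝ, Integrable (fun t => green u v x t / θ t * f t)) ∧
    MemLp (opS u v μ θ f) p volume ∧
    eLpNorm (opS u v μ θ f) p volume ≤ C * eLpNorm f p volume

end SturmLiouville

end

/-!
Along a positive decreasing solution `u` and a positive increasing solution `v` of `z'' = q z` with
Wronskian one, `v` grows at least linearly at `+∞` and `u` at `-∞`. If `a u + b v` with `b ≠ 0` were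
in `L_{p,μ}`, then `μ (1 + |x|)` would be in `L_p` near `+∞`, and Hölder's inequality with
`(1 + |x|)⁻¹` would make `μ` integrable there. Hence no nonzero solution of the homogeneous equation
is in `L_{p,μ}`, and for compactly supported `f` the Green potential `∫ G(x,t) f(t) dt`, which is a
multiple of `v` near `-∞` and of `u` near `+∞`, is the only possible solution in `L_{p,μ}`. Since
`G > 0`, the admissibility estimate for truncations of `|f|` passes to the limit by Fatou's lemma,
which gives the boundedness of `S`. For the converse, the Green potential of `f` is a solution, with
the required estimate.

The solution `u` is obtained by shooting: if `φ, ψ` solve the homogeneous equation with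
`φ(0) = 1`, `φ'(0) = 0`, `ψ(0) = 0`, `ψ'(0) = 1`, then `φ / ψ` decreases on `(0, ∞)` to some
`m`, and `u = φ - m ψ` is positive and decreasing. Reflection `x ↦ -x` gives `v`.
-/

noncomputable section

namespace SturmLiouville

lemma intervalIntegrable_of_locallyIntegrable {E : Type*} [NormedAddCommGroup E] {f : ℝ → E}
    (hf : LocallyIntegrable f volume) (a b : ℝ) : IntervalIntegrable f volume a b :=
  (hf.integrableOn_isCompact isCompact_uIcc).intervalIntegrable

lemma locallyIntegrable_of_intervalIntegrable {E : Type*} [NormedAddCommGroup E] {f : ℝ → E}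
    (hf : ∀ a b, IntervalIntegrable f volume a b) : LocallyIntegrable f volume := fun x =>
  ⟨Ioc (x - 1) (x + 1), Ioc_mem_nhds (by linarith) (by linarith),
    (intervalIntegrable_iff_integrableOn_Ioc_of_le (by linarith)).1 (hf _ _)⟩

lemma locallyIntegrable_norm {E : Type*} [NormedAddCommGroup E] {f : ℝ → E}
    (hf : LocallyIntegrable f volume) : LocallyIntegrable (fun x => ‖f x‖) volume :=
  locallyIntegrable_of_intervalIntegrable fun a b =>
    (intervalIntegrable_of_locallyIntegrable hf a b).norm

lemma locallyIntegrable_comp_neg {f : ℝ → ℝ} (hf : LocallyIntegrable f volume) :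
    LocallyIntegrable (fun x => f (-x)) volume :=
  locallyIntegrable_of_intervalIntegrable fun a b => by
    simpa using (intervalIntegrable_of_locallyIntegrable hf (-a) (-b)).comp_sub_left 0

lemma absolutelyContinuousOnInterval_comp_of_lipschitzOn {X Y : Type*} [PseudoMetricSpace X]
    [PseudoMetricSpace Y] {φ : X → Y} {F : ℝ → X} {s : Set X} {K : ℝ≥0} {a b : ℝ}
    (hφ : LipschitzOnWith K φ s) (hF : AbsolutelyContinuousOnInterval F a b)
    (hs : MapsTo F (uIcc a b) s) : AbsolutelyContinuousOnInterval (fun x => φ (F x)) a b := by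
  rw [absolutelyContinuousOnInterval_iff] at hF ⊢
  intro ε hε
  obtain ⟨δ, hδ, hFδ⟩ := hF (ε / (K + 1)) (by positivity)
  refine ⟨δ, hδ, fun I hI hIδ => ?_⟩
  calc ∑ i ∈ Finset.range I.1, dist (φ (F (I.2 i).1)) (φ (F (I.2 i).2))
      ≤ ∑ i ∈ Finset.range I.1, (K + 1) * dist (F (I.2 i).1) (F (I.2 i).2) := by
        refine Finset.sum_le_sum fun i hi => ?_
        refine (hφ.dist_le_mul _ (hs (hI.1 i hi).1) _ (hs (hI.1 i hi).2)).trans ?_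
        gcongr
        exact le_add_of_nonneg_right zero_le_one
    _ = (K + 1) * ∑ i ∈ Finset.range I.1, dist (F (I.2 i).1) (F (I.2 i).2) :=
        (Finset.mul_sum _ _ _).symm
    _ < ε := (lt_div_iff₀' (by positivity)).1 (hFδ I hI hIδ)

/-- `F` is an indefinite integral of the locally integrable function `f`. Equivalently, `F` is
absolutely continuous on compact intervals and `F' = f` almost everywhere. -/
structure IsPrimitive (F f : ℝ → ℝ) : Prop where
  locallyIntegrable : LocallyIntegrable f volume
  sub_eq : ∀ a b : ℝ, F b - F a = ∫ x in a..b, f x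

lemma isPrimitive_integral {f : ℝ → ℝ} (hf : LocallyIntegrable f volume) (a : ℝ) :
    IsPrimitive (fun x => ∫ t in a..x, f t) f where
  locallyIntegrable := hf
  sub_eq _ _ := intervalIntegral.integral_interval_sub_left
    (intervalIntegrable_of_locallyIntegrable hf _ _)
    (intervalIntegrable_of_locallyIntegrable hf _ _)

namespace IsPrimitive

variable {F f G g : ℝ → ℝ}

lemma eq_add_integral (h : IsPrimitive F f) (a : ℝ) : F = fun x => F a + ∫ t in a..x, f t := by
  ext x
  rw [← h.sub_eq, add_sub_cancel]

lemma of_eq_add_integral {c a : ℝ} (hf : LocallyIntegrable f volume)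
    (hF : ∀ x, F x = c + ∫ t in a..x, f t) : IsPrimitive F f where
  locallyIntegrable := hf
  sub_eq x y := by
    rw [hF, hF, add_sub_add_left_eq_sub, (isPrimitive_integral hf a).sub_eq]

lemma absolutelyContinuous (h : IsPrimitive F f) (a b : ℝ) :
    AbsolutelyContinuousOnInterval F a b := by
  have hconst : AbsolutelyContinuousOnInterval (fun _ : ℝ => F a) a b :=
    (LipschitzWith.const (F a)).lipschitzOnWith.absolutelyContinuousOnInterval
  rw [h.eq_add_integral a]
  exact hconst.fun_add ((intervalIntegrable_of_locallyIntegrable h.locallyIntegrable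
    a b).absolutelyContinuousOnInterval_intervalIntegral left_mem_uIcc)

lemma continuous (h : IsPrimitive F f) : Continuous F := by
  rw [h.eq_add_integral 0]
  exact continuous_const.add (intervalIntegral.continuous_primitive
    (intervalIntegrable_of_locallyIntegrable h.locallyIntegrable) 0)

lemma ae_hasDerivAt (h : IsPrimitive F f) : ∀ᵐ x : ℝ, HasDerivAt F (f x) x := by
  rw [h.eq_add_integral 0]
  filter_upwards [LocallyIntegrable.ae_hasDerivAt_integral h.locallyIntegrable] with x hx
  exact (hx 0).const_add _

lemma hasDerivAt (h : IsPrimitive F f) (hf : Continuous f) (x : ℝ) : HasDerivAt F (f x) x := by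
  rw [h.eq_add_integral 0]
  exact (hf.integral_hasStrictDerivAt 0 x).hasDerivAt.const_add _

lemma of_absolutelyContinuous (hF : ∀ a b, AbsolutelyContinuousOnInterval F a b)
    (hf : ∀ᵐ x : ℝ, HasDerivAt F (f x) x) : IsPrimitive F f := by
  have hderiv : deriv F =ᵐ[volume] f := hf.mono fun x hx => hx.deriv
  refine ⟨locallyIntegrable_of_intervalIntegrable fun a b =>
    (hF a b).intervalIntegrable_deriv.congr_ae (ae_restrict_of_ae hderiv), fun a b => ?_⟩
  rw [← (hF a b).integral_deriv_eq_sub]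
  exact intervalIntegral.integral_congr_ae (hderiv.mono fun x hx _ => hx)

lemma of_hasDerivAt (hF : ∀ x, HasDerivAt F (f x) x) (hf : Continuous f) : IsPrimitive F f :=
  ⟨hf.locallyIntegrable, fun a b => (intervalIntegral.integral_eq_sub_of_hasDerivAt
    (fun x _ => hF x) (hf.intervalIntegrable a b)).symm⟩

lemma congr (h : IsPrimitive F f) (hfg : ∀ x, f x = g x) : IsPrimitive F g :=
  funext hfg ▸ h

lemma add (hF : IsPrimitive F f) (hG : IsPrimitive G g) :
    IsPrimitive (fun x => F x + G x) (fun x => f x + g x) :=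
  of_absolutelyContinuous
    (fun a b => (hF.absolutelyContinuous a b).fun_add (hG.absolutelyContinuous a b))
    (by filter_upwards [hF.ae_hasDerivAt, hG.ae_hasDerivAt] with x hx hx' using hx.add hx')

lemma sub (hF : IsPrimitive F f) (hG : IsPrimitive G g) :
    IsPrimitive (fun x => F x - G x) (fun x => f x - g x) :=
  of_absolutelyContinuous
    (fun a b => (hF.absolutelyContinuous a b).fun_sub (hG.absolutelyContinuous a b))
    (by filter_upwards [hF.ae_hasDerivAt, hG.ae_hasDerivAt] with x hx hx' using hx.sub hx')

lemma mul (hF : IsPrimitive F f) (hG : IsPrimitive G g) :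
    IsPrimitive (fun x => F x * G x) (fun x => f x * G x + F x * g x) :=
  of_absolutelyContinuous
    (fun a b => (hF.absolutelyContinuous a b).fun_mul (hG.absolutelyContinuous a b))
    (by filter_upwards [hF.ae_hasDerivAt, hG.ae_hasDerivAt] with x hx hx' using hx.mul hx')

lemma const_mul (c : ℝ) (hF : IsPrimitive F f) :
    IsPrimitive (fun x => c * F x) (fun x => c * f x) :=
  of_absolutelyContinuous (fun a b => (hF.absolutelyContinuous a b).const_mul c)
    (hF.ae_hasDerivAt.mono fun _ hx => hx.const_mul c)

lemma neg_comp_neg (hF : IsPrimitive F f) :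
    IsPrimitive (fun x => -F (-x)) (fun x => f (-x)) where
  locallyIntegrable := locallyIntegrable_comp_neg hF.locallyIntegrable
  sub_eq a b := by
    rw [intervalIntegral.integral_comp_neg, ← hF.sub_eq]
    ring

lemma comp {φ φ' : ℝ → ℝ} (hφ : ∀ x, HasDerivAt φ (φ' x) x) (hφ' : Continuous φ')
    (hF : IsPrimitive F f) : IsPrimitive (fun x => φ (F x)) (fun x => φ' (F x) * f x) := by
  have hφ1 : ContDiff ℝ 1 φ := contDiff_one_iff_deriv.2
    ⟨fun x => (hφ x).differentiableAt, by rwa [funext fun x => (hφ x).deriv]⟩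
  refine of_absolutelyContinuous (fun a b => ?_)
    (hF.ae_hasDerivAt.mono fun x hx => (hφ (F x)).comp x hx)
  obtain ⟨C, hC⟩ := (hF.absolutelyContinuous a b).exists_bound
  obtain ⟨K, hK⟩ := (hφ1.contDiffOn (s := Icc (-C) C)).exists_lipschitzOnWith one_ne_zero
    (convex_Icc _ _) isCompact_Icc
  exact absolutelyContinuousOnInterval_comp_of_lipschitzOn hK (hF.absolutelyContinuous a b)
    fun x hx => abs_le.1 (hC x hx)

lemma le_of_ae_nonneg (hF : IsPrimitive F f) {a b : ℝ} (hab : a ≤ b)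
    (hf : ∀ᵐ x : ℝ, x ∈ Icc a b → 0 ≤ f x) : F a ≤ F b := by
  rw [← sub_nonneg, hF.sub_eq]
  exact intervalIntegral.integral_nonneg_of_ae_restrict hab
    ((ae_restrict_iff' measurableSet_Icc).2 hf)

end IsPrimitive

namespace IsSolution

variable {q f y z : ℝ → ℝ}

lemma hasDerivAt (h : IsSolution q f y) (x : ℝ) : HasDerivAt y (deriv y x) x :=
  (h.differentiable x).hasDerivAt

lemma continuous (h : IsSolution q f y) : Continuous y := h.differentiable.continuous

lemma isPrimitive_deriv (h : IsSolution q f y) :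
    IsPrimitive (deriv y) (fun x => q x * y x - f x) := by
  refine IsPrimitive.of_absolutelyContinuous h.ac_deriv ?_
  have hdiff : ∀ᵐ x : ℝ, ∀ n : ℕ, x ∈ uIcc (-n : ℝ) n → DifferentiableAt ℝ (deriv y) x :=
    ae_all_iff.2 fun n => (h.ac_deriv (-n) n).ae_differentiableAt
  filter_upwards [h.eq_ae, hdiff] with x hx hx'
  obtain ⟨n, hn⟩ := exists_nat_ge |x|
  rw [show q x * y x - f x = deriv (deriv y) x by linarith]
  exact (hx' n (Icc_subset_uIcc (abs_le.1 hn))).hasDerivAt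

lemma continuous_deriv (h : IsSolution q f y) : Continuous (deriv y) :=
  h.isPrimitive_deriv.continuous

lemma isPrimitive (h : IsSolution q f y) : IsPrimitive y (deriv y) :=
  .of_hasDerivAt h.hasDerivAt h.continuous_deriv

lemma of_hasDerivAt (hy : ∀ x, HasDerivAt y (z x) x)
    (hz : IsPrimitive z (fun x => q x * y x - f x)) : IsSolution q f y := by
  obtain rfl : deriv y = z := funext fun x => (hy x).deriv
  refine ⟨fun x => (hy x).differentiableAt,
    (IsPrimitive.of_hasDerivAt hy hz.continuous).absolutelyContinuous,
    hz.absolutelyContinuous, ?_⟩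
  filter_upwards [hz.ae_hasDerivAt] with x hx
  rw [hx.deriv]
  ring

variable {y₁ y₂ : ℝ → ℝ}

lemma hasDerivAt_comb {f₁ f₂ : ℝ → ℝ} (h₁ : IsSolution q f₁ y₁) (h₂ : IsSolution q f₂ y₂)
    (a b x : ℝ) :
    HasDerivAt (fun x => a * y₁ x + b * y₂ x) (a * deriv y₁ x + b * deriv y₂ x) x :=
  ((h₁.hasDerivAt x).const_mul a).add ((h₂.hasDerivAt x).const_mul b)

lemma comb {f₁ f₂ : ℝ → ℝ} (h₁ : IsSolution q f₁ y₁) (h₂ : IsSolution q f₂ y₂) (a b : ℝ) :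
    IsSolution q (fun x => a * f₁ x + b * f₂ x) (fun x => a * y₁ x + b * y₂ x) :=
  of_hasDerivAt (h₁.hasDerivAt_comb h₂ a b)
    (((h₁.isPrimitive_deriv.const_mul a).add (h₂.isPrimitive_deriv.const_mul b)).congr
      fun x => by ring)

lemma comb_zero (h₁ : IsSolution q (fun _ => 0) y₁) (h₂ : IsSolution q (fun _ => 0) y₂)
    (a b : ℝ) : IsSolution q (fun _ => 0) (fun x => a * y₁ x + b * y₂ x) := by
  simpa using h₁.comb h₂ a b

lemma sub (h₁ : IsSolution q f y₁) (h₂ : IsSolution q f y₂) :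
    IsSolution q (fun _ => 0) (fun x => y₁ x - y₂ x) := by
  simpa [← sub_eq_add_neg] using h₁.comb h₂ 1 (-1)

lemma hasDerivAt_comp_neg (h : IsSolution q f y) (x : ℝ) :
    HasDerivAt (fun x => y (-x)) (-deriv y (-x)) x :=
  ((h.hasDerivAt (-x)).comp x (hasDerivAt_neg x)).congr_deriv (mul_neg_one _)

lemma comp_neg (h : IsSolution q f y) :
    IsSolution (fun x => q (-x)) (fun x => f (-x)) (fun x => y (-x)) :=
  of_hasDerivAt h.hasDerivAt_comp_neg h.isPrimitive_deriv.neg_comp_neg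

lemma wronskian_eq (h₁ : IsSolution q (fun _ => 0) y₁) (h₂ : IsSolution q (fun _ => 0) y₂)
    (a b : ℝ) :
    deriv y₂ a * y₁ a - deriv y₁ a * y₂ a = deriv y₂ b * y₁ b - deriv y₁ b * y₂ b := by
  have hW := (h₂.isPrimitive_deriv.mul h₁.isPrimitive).sub
    (h₁.isPrimitive_deriv.mul h₂.isPrimitive)
  have hW0 := (hW.congr (g := fun _ => 0) fun x => by ring).sub_eq a b
  rw [intervalIntegral.integral_zero] at hW0
  linarith

end IsSolution

section LinearSystem

open BoundedContinuousFunction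

variable {E : Type*} [NormedAddCommGroup E] [NormedSpace ℝ E] {A : ℝ → E →L[ℝ] E}

/-- The weight of a Bielecki norm adapted to the linear system `Y' = A Y`: in the supremum norm of
`Y / bieleckiWeight A`, the Volterra operator `Y ↦ ∫₀ˣ A Y` is a contraction on the whole line. -/
def bieleckiWeight (A : ℝ → E →L[ℝ] E) (x : ℝ) : ℝ :=
  Real.cosh (2 * ∫ t in (0 : ℝ)..x, ‖A t‖)

lemma bieleckiWeight_pos (A : ℝ → E →L[ℝ] E) (x : ℝ) : 0 < bieleckiWeight A x :=
  Real.cosh_pos _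

lemma continuous_bieleckiWeight (hA : LocallyIntegrable A volume) :
    Continuous (bieleckiWeight A) :=
  Real.continuous_cosh.comp
    ((isPrimitive_integral (locallyIntegrable_norm hA) 0).continuous.const_mul 2)

lemma locallyIntegrable_clm_apply (hA : LocallyIntegrable A volume) {Y : ℝ → E}
    (hY : Continuous Y) : LocallyIntegrable (fun t => A t (Y t)) volume := by
  refine ((locallyIntegrable_norm hA).mul_continuous hY.norm).mono ?_ (.of_forall fun t => ?_)
  · exact (ContinuousLinearMap.id ℝ (E →L[ℝ] E)).aestronglyMeasurable_comp₂
      hA.aestronglyMeasurable hY.aestronglyMeasurable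
  · rw [norm_mul, norm_norm, norm_norm]
    exact (A t).le_opNorm _

lemma isPrimitive_sinh_integral_norm (hA : LocallyIntegrable A volume) :
    IsPrimitive (fun x => Real.sinh (2 * ∫ t in (0 : ℝ)..x, ‖A t‖) / 2)
      (fun x => bieleckiWeight A x * ‖A x‖) :=
  (isPrimitive_integral (locallyIntegrable_norm hA) 0).comp (φ := fun s => Real.sinh (2 * s) / 2)
    (φ' := fun s => Real.cosh (2 * s))
    (fun s => (((hasDerivAt_id s).const_mul 2).sinh.div_const 2).congr_deriv
      (by simp only [id]; ring)) (by fun_prop)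

lemma norm_integral_clm_apply_le (hA : LocallyIntegrable A volume) {Y : ℝ → E} {C : ℝ}
    (hY : ∀ t, ‖Y t‖ ≤ C * bieleckiWeight A t) (x : ℝ) :
    ‖∫ t in (0 : ℝ)..x, A t (Y t)‖ ≤ C / 2 * bieleckiWeight A x := by
  have hC : 0 ≤ C := nonneg_of_mul_nonneg_left ((norm_nonneg _).trans (hY 0))
    (bieleckiWeight_pos A 0)
  have hS := (isPrimitive_sinh_integral_norm hA).const_mul C
  have hdom : ∀ t, ‖A t (Y t)‖ ≤ C * (bieleckiWeight A t * ‖A t‖) := fun t =>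
    calc ‖A t (Y t)‖ ≤ ‖A t‖ * (C * bieleckiWeight A t) := (A t).le_opNorm_of_le (hY t)
      _ = C * (bieleckiWeight A t * ‖A t‖) := by ring
  calc ‖∫ t in (0 : ℝ)..x, A t (Y t)‖
      ≤ |∫ t in (0 : ℝ)..x, C * (bieleckiWeight A t * ‖A t‖)| :=
        intervalIntegral.norm_integral_le_abs_of_norm_le (.of_forall hdom)
          (intervalIntegrable_of_locallyIntegrable hS.locallyIntegrable _ _)
    _ = C / 2 * Real.sinh |2 * ∫ t in (0 : ℝ)..x, ‖A t‖| := by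
        rw [← hS.sub_eq]
        simp only [intervalIntegral.integral_same, mul_zero, Real.sinh_zero, zero_div, sub_zero]
        rw [abs_mul, abs_div, Real.abs_sinh, abs_two, abs_of_nonneg hC]
        ring
    _ ≤ C / 2 * bieleckiWeight A x := by
        rw [bieleckiWeight, ← Real.cosh_abs]
        gcongr
        exact (Real.sinh_lt_cosh _).le

lemma exists_bielecki_picard (hA : LocallyIntegrable A volume) (Y₀ : E) :
    ∃ T : (ℝ →ᵇ E) → (ℝ →ᵇ E), ContractingWith (1 / 2) T ∧
      ∀ w x, bieleckiWeight A x • T w x =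
        Y₀ + ∫ t in (0 : ℝ)..x, A t (bieleckiWeight A t • w t) := by
  set W := bieleckiWeight A
  have hW : Continuous W := continuous_bieleckiWeight hA
  have hW0 : ∀ x, 0 < W x := bieleckiWeight_pos A
  have hint : ∀ w : ℝ →ᵇ E, ∀ a b,
      IntervalIntegrable (fun t => A t (W t • w t)) volume a b := fun w =>
    intervalIntegrable_of_locallyIntegrable (locallyIntegrable_clm_apply hA (hW.smul w.continuous))
  have hbound : ∀ (w : ℝ →ᵇ E) x,
      ‖∫ t in (0 : ℝ)..x, A t (W t • w t)‖ ≤ ‖w‖ / 2 * W x := fun w =>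
    norm_integral_clm_apply_le hA fun t => by
      rw [norm_smul, Real.norm_of_nonneg (hW0 t).le, mul_comm]
      gcongr
      exacts [(hW0 t).le, w.norm_coe_le_norm t]
  let T (w : ℝ →ᵇ E) : ℝ →ᵇ E := .ofNormedAddCommGroup
    (fun x => (W x)⁻¹ • (Y₀ + ∫ t in (0 : ℝ)..x, A t (W t • w t)))
    ((hW.inv₀ fun x => (hW0 x).ne').smul
      (continuous_const.add (intervalIntegral.continuous_primitive (hint w) 0)))
    (‖Y₀‖ + ‖w‖ / 2) fun x => by
      rw [norm_smul, norm_inv, Real.norm_of_nonneg (hW0 x).le, inv_mul_le_iff₀ (hW0 x)]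
      have hY₀ : ‖Y₀‖ ≤ W x * ‖Y₀‖ := le_mul_of_one_le_left (norm_nonneg _) (Real.one_le_cosh _)
      linarith [norm_add_le Y₀ (∫ t in (0 : ℝ)..x, A t (W t • w t)), hbound w x]
  refine ⟨T, ⟨by norm_num [← NNReal.coe_lt_coe], LipschitzWith.of_dist_le_mul fun w w' => ?_⟩,
    fun w x => smul_inv_smul₀ (hW0 x).ne' _⟩
  rw [BoundedContinuousFunction.dist_le (by positivity)]
  intro x
  have hdiff : T w x - T w' x = (W x)⁻¹ • ∫ t in (0 : ℝ)..x, A t (W t • (w - w') t) := by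
    simp only [BoundedContinuousFunction.sub_apply, smul_sub, map_sub]
    rw [intervalIntegral.integral_sub (hint w 0 x) (hint w' 0 x)]
    simp only [T, coe_ofNormedAddCommGroup]
    rw [← smul_sub, add_sub_add_left_eq_sub]
  rw [dist_eq_norm, hdiff, norm_smul, norm_inv, Real.norm_of_nonneg (hW0 x).le,
    inv_mul_le_iff₀ (hW0 x), dist_eq_norm]
  exact (hbound (w - w') x).trans_eq (by simp; ring)

lemma exists_continuous_eq_add_integral [CompleteSpace E] (hA : LocallyIntegrable A volume)
    (Y₀ : E) : ∃ Y : ℝ → E, Continuous Y ∧ ∀ x, Y x = Y₀ + ∫ t in (0 : ℝ)..x, A t (Y t) := by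
  obtain ⟨T, hT, hTeq⟩ := exists_bielecki_picard hA Y₀
  refine ⟨fun x => bieleckiWeight A x • ContractingWith.fixedPoint T hT x,
    (continuous_bieleckiWeight hA).smul (ContractingWith.fixedPoint T hT).continuous,
    fun x => ?_⟩
  rw [← hTeq, hT.fixedPoint_isFixedPt.eq]

end LinearSystem

lemma exists_isSolution {q : ℝ → ℝ} (hq : LocallyIntegrable q volume) (a b : ℝ) :
    ∃ y, IsSolution q (fun _ => 0) y ∧ y 0 = a ∧ deriv y 0 = b := by
  -- The companion system `(y, z)' = (z, q y)`.
  let P : ℝ × ℝ →L[ℝ] ℝ × ℝ := (ContinuousLinearMap.snd ℝ ℝ ℝ).prod 0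
  let R : ℝ × ℝ →L[ℝ] ℝ × ℝ := (0 : ℝ × ℝ →L[ℝ] ℝ).prod (ContinuousLinearMap.fst ℝ ℝ ℝ)
  have hA : LocallyIntegrable (fun t => P + q t • R) volume :=
    (locallyIntegrable_const P).add (hq.smul_continuous continuous_const)
  obtain ⟨Y, hY, hYeq⟩ := exists_continuous_eq_add_integral hA (a, b)
  have hint := intervalIntegrable_of_locallyIntegrable (locallyIntegrable_clm_apply hA hY)
  have hy : ∀ x, (Y x).1 = a + ∫ t in (0 : ℝ)..x, (Y t).2 := fun x => by
    conv_lhs => rw [hYeq x]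
    rw [Prod.fst_add, ← ContinuousLinearMap.coe_fst' (R := ℝ),
      ← ContinuousLinearMap.intervalIntegral_comp_comm _ (hint 0 x)]
    simp [P, R]
  have hz : ∀ x, (Y x).2 = b + ∫ t in (0 : ℝ)..x, q t * (Y t).1 := fun x => by
    conv_lhs => rw [hYeq x]
    rw [Prod.snd_add, ← ContinuousLinearMap.coe_snd' (R := ℝ),
      ← ContinuousLinearMap.intervalIntegral_comp_comm _ (hint 0 x)]
    simp [P, R]
  have hderiv : ∀ x, HasDerivAt (fun x => (Y x).1) (Y x).2 x :=
    (IsPrimitive.of_eq_add_integral hY.snd.locallyIntegrable hy).hasDerivAt hY.snd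
  have hprim := IsPrimitive.of_eq_add_integral (hq.mul_continuous hY.fst) hz
  exact ⟨_, .of_hasDerivAt hderiv (hprim.congr fun x => (sub_zero _).symm), by simp [hy],
    by simp [(hderiv 0).deriv, hz]⟩

lemma ae_nonneg_comp_neg {q : ℝ → ℝ} (hq : ∀ᵐ x : ℝ, 0 ≤ q x) : ∀ᵐ x : ℝ, 0 ≤ q (-x) :=
  (Measure.measurePreserving_neg (volume : Measure ℝ)).quasiMeasurePreserving.ae hq

lemma setLIntegral_Ici_comp_neg (f : ℝ → ℝ≥0∞) (x : ℝ) :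
    ∫⁻ t in Ici x, f (-t) = ∫⁻ t in Iic (-x), f t := by
  simpa using (Measure.measurePreserving_neg (volume : Measure ℝ)).setLIntegral_comp_preimage_emb
    (MeasurableEquiv.neg ℝ).measurableEmbedding f (Iic (-x))

namespace IsSolution

variable {q z : ℝ → ℝ} {a b x : ℝ}

lemma deriv_le_deriv (hq : ∀ᵐ x : ℝ, 0 ≤ q x) (hz : IsSolution q (fun _ => 0) z) (hab : a ≤ b)
    (hpos : ∀ x ∈ Icc a b, 0 ≤ z x) : deriv z a ≤ deriv z b := by
  refine hz.isPrimitive_deriv.le_of_ae_nonneg hab ?_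
  filter_upwards [hq] with x hqx hx
  simpa using mul_nonneg hqx (hpos x hx)

lemma pos_of_le (hq : ∀ᵐ x : ℝ, 0 ≤ q x) (hz : IsSolution q (fun _ => 0) z) (ha : 0 < z a)
    (ha' : 0 ≤ deriv z a) (hx : a ≤ x) : 0 < z x := by
  -- `(z z')' = z'² + q z² ≥ 0`, so `z²` increases to the right of `a` and `z` cannot vanish there.
  have hzz' : ∀ t, a ≤ t → 0 ≤ z t * deriv z t := fun t ht => by
    refine (mul_nonneg ha.le ha').trans
      ((hz.isPrimitive.mul hz.isPrimitive_deriv).le_of_ae_nonneg ht ?_)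
    filter_upwards [hq] with s hs _
    nlinarith [mul_nonneg hs (sq_nonneg (z s)), sq_nonneg (deriv z s)]
  have hsq : ∀ t, a ≤ t → z a * z a ≤ z t * z t := fun t ht =>
    (hz.isPrimitive.mul hz.isPrimitive).le_of_ae_nonneg ht
      (.of_forall fun s hs => by linarith [hzz' s hs.1])
  by_contra! hzx
  obtain ⟨s, hs, hs0⟩ := intermediate_value_Icc' hx hz.continuous.continuousOn ⟨hzx, ha.le⟩
  have := hsq s hs.1
  rw [hs0] at this
  nlinarith

lemma pos_of_ge (hq : ∀ᵐ x : ℝ, 0 ≤ q x) (hz : IsSolution q (fun _ => 0) z) (ha : 0 < z a)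
    (ha' : deriv z a ≤ 0) (hx : x ≤ a) : 0 < z x := by
  simpa using hz.comp_neg.pos_of_le (ae_nonneg_comp_neg hq) (a := -a) (x := -x) (by simpa using ha)
    (by simpa [(hz.hasDerivAt_comp_neg _).deriv] using ha') (neg_le_neg hx)

lemma mul_add_mul_pos (hq : ∀ᵐ x : ℝ, 0 ≤ q x) {φ ψ : ℝ → ℝ}
    (hφ : IsSolution q (fun _ => 0) φ) (hψ : IsSolution q (fun _ => 0) ψ) {y : ℝ}
    (hW : 0 < deriv ψ y * φ y - deriv φ y * ψ y) (x : ℝ) :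
    0 < deriv ψ y * φ x - deriv φ y * ψ x := by
  have hs := hφ.comb_zero hψ (deriv ψ y) (-deriv φ y)
  simp only [neg_mul, ← sub_eq_add_neg] at hs
  have hsy' : deriv (fun x => deriv ψ y * φ x - deriv φ y * ψ x) y = 0 :=
    (((hφ.hasDerivAt y).const_mul _).sub ((hψ.hasDerivAt y).const_mul _)).deriv.trans (by ring)
  exact (le_total y x).elim (hs.pos_of_le hq hW hsy'.ge) (hs.pos_of_ge hq hW hsy'.le)

lemma strictAntiOn_div {f₁ f₂ φ ψ : ℝ → ℝ} {s : Set ℝ} (hs : Convex ℝ s)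
    (hφ : IsSolution q f₁ φ) (hψ : IsSolution q f₂ ψ) (hψ0 : ∀ x ∈ s, 0 < ψ x)
    (hW : ∀ x, 0 < deriv ψ x * φ x - deriv φ x * ψ x) :
    StrictAntiOn (fun x => φ x / ψ x) s := by
  refine strictAntiOn_of_deriv_neg hs (hφ.continuous.continuousOn.div
    hψ.continuous.continuousOn fun x hx => (hψ0 x hx).ne') fun x hx => ?_
  have hψx : 0 < ψ x := hψ0 x (interior_subset hx)
  rw [((hφ.hasDerivAt x).fun_div (hψ.hasDerivAt x) hψx.ne').deriv]
  exact div_neg_of_neg_of_pos (by linarith [hW x]) (by positivity)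

lemma deriv_neg_of_pos_of_deriv_nonpos (hq : ∀ᵐ x : ℝ, 0 ≤ q x)
    (hq_right : ∀ x : ℝ, 0 < ∫⁻ t in Ici x, ENNReal.ofReal (q t))
    (hz : IsSolution q (fun _ => 0) z) (hpos : ∀ x, 0 < z x) (hle : ∀ x, deriv z x ≤ 0) (x : ℝ) :
    deriv z x < 0 := by
  refine (hle x).lt_of_ne fun hx => (hq_right x).ne' ?_
  have hzero : ∀ t, x ≤ t → deriv z t = 0 := fun t ht =>
    (hle t).antisymm (hx ▸ hz.deriv_le_deriv hq ht fun s _ => (hpos s).le)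
  have hq0 : ∀ᵐ t : ℝ, t ∈ Ioi x → q t = 0 := by
    filter_upwards [hz.isPrimitive_deriv.ae_hasDerivAt] with t ht htx
    have h0 : HasDerivAt (deriv z) 0 t := (hasDerivAt_const t (0 : ℝ)).congr_of_eventuallyEq <| by
      filter_upwards [Ioi_mem_nhds (mem_Ioi.1 htx)] with s hs using hzero s (le_of_lt hs)
    simpa [(hpos t).ne'] using ht.unique h0
  rw [setLIntegral_congr Ioi_ae_eq_Ici.symm, setLIntegral_congr_fun_ae measurableSet_Ioi
    (g := 0) (hq0.mono fun t ht htx => by simp [ht htx])]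
  simp

end IsSolution

lemma exists_deriv_le_mul_and_mul_lt {q φ ψ : ℝ → ℝ} (hq : ∀ᵐ x : ℝ, 0 ≤ q x)
    (hφ : IsSolution q (fun _ => 0) φ) (hψ : IsSolution q (fun _ => 0) ψ) (h0 : 0 < ψ 0)
    (h0' : 0 < deriv ψ 0) (hW : ∀ x, 0 < deriv ψ x * φ x - deriv φ x * ψ x) :
    ∃ m, ∀ x, 0 ≤ x → deriv φ x ≤ m * deriv ψ x ∧ m * ψ x < φ x := by
  have hψpos : ∀ x, 0 ≤ x → 0 < ψ x := fun x => hψ.pos_of_le hq h0 h0'.le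
  have hψpos' : ∀ x, 0 ≤ x → 0 < deriv ψ x := fun x hx =>
    h0'.trans_le (hψ.deriv_le_deriv hq hx fun t ht => (hψpos t ht.1).le)
  -- Every slope `φ' / ψ'` lies below every value of `φ / ψ`, so the infimum of the latter
  -- separates them; it is not attained because `φ / ψ` is strictly decreasing.
  have hslope : ∀ x y, 0 ≤ x → 0 ≤ y → deriv φ y / deriv ψ y ≤ φ x / ψ x := fun x y hx hy => by
    rw [div_le_div_iff₀ (hψpos' y hy) (hψpos x hx)]
    linarith [IsSolution.mul_add_mul_pos hq hφ hψ (hW y) x]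
  refine ⟨sInf ((fun x => φ x / ψ x) '' Ici 0), fun x hx => ⟨?_, ?_⟩⟩
  · rw [← div_le_iff₀ (hψpos' x hx)]
    exact le_csInf (nonempty_Ici.image _) (forall_mem_image.2 fun y hy => hslope y x hy hx)
  · rw [← lt_div_iff₀ (hψpos x hx)]
    have hx1 : x + 1 ∈ Ici (0 : ℝ) := by simp only [mem_Ici]; linarith
    calc sInf ((fun x => φ x / ψ x) '' Ici 0)
        ≤ φ (x + 1) / ψ (x + 1) :=
          csInf_le ⟨_, forall_mem_image.2 fun y hy => hslope y 0 hy le_rfl⟩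
            (mem_image_of_mem _ hx1)
      _ < φ x / ψ x :=
          IsSolution.strictAntiOn_div (convex_Ici 0) hφ hψ hψpos hW hx hx1 (lt_add_one x)

lemma exists_pos_deriv_nonpos {q : ℝ → ℝ} (hq_loc : LocallyIntegrable q volume)
    (hq : ∀ᵐ x : ℝ, 0 ≤ q x) :
    ∃ u, IsSolution q (fun _ => 0) u ∧ (∀ x, 0 < u x) ∧ ∀ x, deriv u x ≤ 0 := by
  obtain ⟨φ, hφ, hφ0, hφ0'⟩ := exists_isSolution hq_loc 1 0
  obtain ⟨ψ, hψ, hψ0, hψ0'⟩ := exists_isSolution hq_loc 1 1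
  have hW : ∀ x, 0 < deriv ψ x * φ x - deriv φ x * ψ x := fun x => by
    rw [hφ.wronskian_eq hψ x 0, hφ0, hφ0', hψ0, hψ0']
    norm_num
  obtain ⟨m, hm⟩ := exists_deriv_le_mul_and_mul_lt hq hφ hψ (by simp [hψ0]) (by simp [hψ0']) hW
  have hu := hφ.comb_zero hψ 1 (-m)
  have hright : ∀ x, 0 ≤ x → 0 < 1 * φ x + -m * ψ x ∧
      deriv (fun x => 1 * φ x + -m * ψ x) x ≤ 0 := fun x hx => by
    rw [(hφ.hasDerivAt_comb hψ 1 (-m) x).deriv]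
    constructor <;> linarith [hm x hx]
  have hpos : ∀ x, 0 < 1 * φ x + -m * ψ x := fun x => (le_total 0 x).elim
    (fun hx => (hright x hx).1) (hu.pos_of_ge hq (hright 0 le_rfl).1 (hright 0 le_rfl).2)
  refine ⟨_, hu, hpos, fun x => (le_total 0 x).elim (fun hx => (hright x hx).2) fun hx => ?_⟩
  exact (hu.deriv_le_deriv hq hx fun t _ => (hpos t).le).trans (hright 0 le_rfl).2

lemma exists_pos_deriv_neg {q : ℝ → ℝ} (hq_loc : LocallyIntegrable q volume)
    (hq : ∀ᵐ x : ℝ, 0 ≤ q x) (hq_right : ∀ x : ℝ, 0 < ∫⁻ t in Ici x, ENNReal.ofReal (q t)) :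
    ∃ u, IsSolution q (fun _ => 0) u ∧ (∀ x, 0 < u x) ∧ ∀ x, deriv u x < 0 := by
  obtain ⟨u, hu, hpos, hle⟩ := exists_pos_deriv_nonpos hq_loc hq
  exact ⟨u, hu, hpos, hu.deriv_neg_of_pos_of_deriv_nonpos hq hq_right hpos hle⟩

/-- Positive functions `u` decreasing and `v` increasing with Wronskian one: the part of `IsFSS`
which makes no reference to the equation, and from which the asymptotics of `u / v` follow. -/
structure IsMonotonePair (u v : ℝ → ℝ) : Prop where
  differentiable_u : Differentiable ℝ u
  differentiable_v : Differentiable ℝ v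
  pos_u : ∀ x, 0 < u x
  pos_v : ∀ x, 0 < v x
  deriv_u_neg : ∀ x, deriv u x < 0
  deriv_v_pos : ∀ x, 0 < deriv v x
  wronskian : ∀ x, deriv v x * u x - deriv u x * v x = 1

namespace IsMonotonePair

variable {u v : ℝ → ℝ}

lemma comp_neg (h : IsMonotonePair u v) :
    IsMonotonePair (fun x => v (-x)) (fun x => u (-x)) where
  differentiable_u := h.differentiable_v.comp differentiable_neg
  differentiable_v := h.differentiable_u.comp differentiable_neg
  pos_u x := h.pos_v (-x)
  pos_v x := h.pos_u (-x)
  deriv_u_neg x := by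
    rw [deriv_comp_neg]
    exact neg_neg_of_pos (h.deriv_v_pos (-x))
  deriv_v_pos x := by
    rw [deriv_comp_neg]
    exact neg_pos_of_neg (h.deriv_u_neg (-x))
  wronskian x := by
    rw [deriv_comp_neg, deriv_comp_neg]
    linarith [h.wronskian (-x)]

lemma strictAnti (h : IsMonotonePair u v) : StrictAnti u := strictAnti_of_deriv_neg h.deriv_u_neg

lemma hasDerivAt_mul (h : IsMonotonePair u v) (x : ℝ) :
    HasDerivAt (fun s => u s * v s) (deriv u x * v x + u x * deriv v x) x :=
  (h.differentiable_u x).hasDerivAt.mul (h.differentiable_v x).hasDerivAt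

lemma abs_deriv_mul_lt (h : IsMonotonePair u v) (x : ℝ) : |deriv (fun s => u s * v s) x| < 1 := by
  rw [(h.hasDerivAt_mul x).deriv, abs_lt]
  constructor <;> linarith [h.wronskian x, mul_pos (h.deriv_v_pos x) (h.pos_u x),
    mul_neg_of_neg_of_pos (h.deriv_u_neg x) (h.pos_v x)]

lemma exists_mul_one_add_le (h : IsMonotonePair u v) :
    ∃ c > 0, ∀ x, 0 ≤ x → c * (1 + x) ≤ v x := by
  -- By the Wronskian identity, `2 u(0) v - u v - x` has derivative `2 (u(0) - u) v' ≥ 0`.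
  have hderiv : ∀ x, HasDerivAt (fun s => 2 * u 0 * v s - u s * v s - s)
      (2 * (u 0 - u x) * deriv v x) x := fun x =>
    ((((h.differentiable_v x).hasDerivAt.const_mul (2 * u 0)).sub (h.hasDerivAt_mul x)).sub
      (hasDerivAt_id x)).congr_deriv (by linear_combination h.wronskian x)
  have hmono : MonotoneOn (fun s => 2 * u 0 * v s - u s * v s - s) (Ici 0) := by
    refine monotoneOn_of_deriv_nonneg (convex_Ici 0)
      (fun x _ => (hderiv x).continuousAt.continuousWithinAt)
      (fun x _ => (hderiv x).differentiableAt.differentiableWithinAt) fun x hx => ?_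
    rw [(hderiv x).deriv]
    have hux : u x ≤ u 0 := h.strictAnti.antitone (interior_subset hx)
    exact mul_nonneg (by linarith) (h.deriv_v_pos x).le
  have hu0 := h.pos_u 0
  refine ⟨min 1 (u 0 * v 0) / (2 * u 0),
    div_pos (lt_min one_pos (mul_pos hu0 (h.pos_v 0))) (by linarith), fun x hx => ?_⟩
  rw [div_mul_eq_mul_div, div_le_iff₀ (by linarith)]
  have hx0 : u 0 * v 0 ≤ 2 * u 0 * v x - u x * v x - x := by
    have := hmono self_mem_Ici hx hx
    simp only [sub_zero] at this
    linarith
  nlinarith [min_le_left 1 (u 0 * v 0), min_le_right 1 (u 0 * v 0),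
    mul_pos (h.pos_u x) (h.pos_v x)]

lemma tendsto_div_atTop (h : IsMonotonePair u v) :
    Tendsto (fun x => u x / v x) atTop (𝓝 0) := by
  obtain ⟨c, hc, hle⟩ := h.exists_mul_one_add_le
  refine tendsto_of_tendsto_of_tendsto_of_le_of_le' tendsto_const_nhds
    ((tendsto_const_nhds (x := u 0)).div_atTop ((tendsto_atTop_add_const_left _ 1
      tendsto_id).const_mul_atTop hc))
    (.of_forall fun x => (div_pos (h.pos_u x) (h.pos_v x)).le) ?_
  filter_upwards [eventually_ge_atTop 0] with x hx
  have hpos : 0 < c * (1 + x) := by positivity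
  exact div_le_div₀ (h.pos_u 0).le (h.strictAnti.antitone hx) hpos (hle x hx)

end IsMonotonePair

namespace IsFSS

variable {q u v : ℝ → ℝ}

lemma isMonotonePair (h : IsFSS q u v) : IsMonotonePair u v :=
  ⟨h.sol_u.differentiable, h.sol_v.differentiable, h.pos_u, h.pos_v, h.deriv_u_neg, h.deriv_v_pos,
    h.wronskian⟩

lemma of_isMonotonePair (hu : IsSolution q (fun _ => 0) u) (hv : IsSolution q (fun _ => 0) v)
    (h : IsMonotonePair u v) : IsFSS q u v where
  sol_u := hu
  sol_v := hv
  pos_u := h.pos_u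
  pos_v := h.pos_v
  deriv_u_neg := h.deriv_u_neg
  deriv_v_pos := h.deriv_v_pos
  wronskian := h.wronskian
  tendsto_atBot := by
    simpa [Function.comp_def] using h.comp_neg.tendsto_div_atTop.comp tendsto_neg_atBot_atTop
  tendsto_atTop := h.tendsto_div_atTop
  abs_deriv_mul_lt := h.abs_deriv_mul_lt

end IsFSS

lemma exists_isFSS {q : ℝ → ℝ} (hq_loc : LocallyIntegrable q volume) (hq : ∀ᵐ x : ℝ, 0 ≤ q x)
    (hq_left : ∀ x : ℝ, 0 < ∫⁻ t in Iic x, ENNReal.ofReal (q t))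
    (hq_right : ∀ x : ℝ, 0 < ∫⁻ t in Ici x, ENNReal.ofReal (q t)) :
    ∃ u v, IsFSS q u v := by
  obtain ⟨u, hu, hu0, hu'⟩ := exists_pos_deriv_neg hq_loc hq hq_right
  obtain ⟨w, hw, hw0, hw'⟩ := exists_pos_deriv_neg (locallyIntegrable_comp_neg hq_loc)
    (ae_nonneg_comp_neg hq) fun x => by
      rw [setLIntegral_Ici_comp_neg (fun t => ENNReal.ofReal (q t))]
      exact hq_left (-x)
  have hz : IsSolution q (fun _ => 0) (fun x => w (-x)) := by simpa using hw.comp_neg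
  have hz' : ∀ x, 0 < deriv (fun x => w (-x)) x := fun x => by
    rw [deriv_comp_neg]
    exact neg_pos_of_neg (hw' (-x))
  set W := deriv (fun x => w (-x)) 0 * u 0 - deriv u 0 * w (-0)
  have hW : 0 < W := sub_pos.2 ((mul_neg_of_neg_of_pos (hu' 0) (hw0 _)).trans
    (mul_pos (hz' 0) (hu0 0)))
  have hv : IsSolution q (fun _ => 0) (fun x => W⁻¹ * w (-x)) := by
    simpa using hz.comb_zero hu W⁻¹ 0
  have hderiv : ∀ x, deriv (fun x => W⁻¹ * w (-x)) x = W⁻¹ * deriv (fun x => w (-x)) x :=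
    fun x => deriv_const_mul _ (hz.differentiable x)
  refine ⟨u, _, .of_isMonotonePair hu hv
    ⟨hu.differentiable, hv.differentiable, hu0, fun x => mul_pos (inv_pos.2 hW) (hw0 _), hu',
      fun x => ?_, fun x => ?_⟩⟩
  · exact hderiv x ▸ mul_pos (inv_pos.2 hW) (hz' x)
  · have hWx : _ = W := hu.wronskian_eq hz x 0
    rw [hderiv]
    linear_combination W⁻¹ * hWx + inv_mul_cancel₀ hW.ne'

namespace IsMonotonePair

variable {u v : ℝ → ℝ}

lemma exists_eventually_atTop_le_abs (h : IsMonotonePair u v) (a : ℝ) {b : ℝ} (hb : b ≠ 0) :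
    ∃ c > 0, ∀ᶠ x in atTop, c * (1 + |x|) ≤ |a * u x + b * v x| := by
  obtain ⟨c, hc, hcv⟩ := h.exists_mul_one_add_le
  have hlim : Tendsto (fun x => |a * (u x / v x) + b|) atTop (𝓝 |b|) := by
    simpa using ((h.tendsto_div_atTop.const_mul a).add_const b).abs
  refine ⟨|b| / 2 * c, by positivity, ?_⟩
  filter_upwards [hlim.eventually_const_le (half_lt_self (abs_pos.2 hb)), eventually_ge_atTop 0]
    with x hx hx0
  have hvx := h.pos_v x
  calc |b| / 2 * c * (1 + |x|) = |b| / 2 * (c * (1 + x)) := by rw [abs_of_nonneg hx0, mul_assoc]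
    _ ≤ |a * (u x / v x) + b| * v x := mul_le_mul hx (hcv x hx0) (by positivity) (abs_nonneg _)
    _ = |(a * (u x / v x) + b) * v x| := by rw [abs_mul, abs_of_pos hvx]
    _ = |a * u x + b * v x| := by rw [add_mul, mul_assoc, div_mul_cancel₀ _ hvx.ne']

lemma exists_eventually_atBot_le_abs (h : IsMonotonePair u v) {a : ℝ} (ha : a ≠ 0) (b : ℝ) :
    ∃ c > 0, ∀ᶠ x in atBot, c * (1 + |x|) ≤ |a * u x + b * v x| := by
  obtain ⟨c, hc, hle⟩ := h.comp_neg.exists_eventually_atTop_le_abs b ha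
  refine ⟨c, hc, (tendsto_neg_atBot_atTop.eventually hle).mono fun x hx => ?_⟩
  simpa [add_comm] using hx

end IsMonotonePair

lemma MemLpLoc.locallyIntegrable {p : ℝ≥0∞} (hp : 1 ≤ p) {f : ℝ → ℝ} (hf : MemLpLoc p f) :
    LocallyIntegrable f volume := by
  rw [locallyIntegrable_iff]
  intro K hK
  have : IsFiniteMeasure (volume.restrict K) := ⟨by simpa using hK.measure_lt_top⟩
  exact (hf K hK).integrable hp

/-- A positive continuous weight, as used to define `L_{p,w}`. -/
structure IsWeight (w : ℝ → ℝ) : Prop where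
  continuous : Continuous w
  pos : ∀ x, 0 < w x

lemma IsWeight.memWeightedLp_iff {p : ℝ≥0∞} (hp : 1 ≤ p) {w f : ℝ → ℝ} (hw : IsWeight w) :
    MemWeightedLp p w f ↔ MemLp (fun x => w x * f x) p volume := by
  refine ⟨fun h => ⟨hw.continuous.aestronglyMeasurable.mul
    (h.1.locallyIntegrable hp).aestronglyMeasurable, h.2⟩, fun h => ⟨fun K hK => ?_, h.2⟩⟩
  have hinv : Continuous fun x => (w x)⁻¹ := hw.continuous.inv₀ fun x => (hw.pos x).ne'
  have hf : (fun x => (w x)⁻¹ * (w x * f x)) = f :=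
    funext fun x => inv_mul_cancel_left₀ (hw.pos x).ne' _
  obtain ⟨C, hC⟩ := hK.exists_bound_of_continuousOn hinv.continuousOn
  have hfm : AEStronglyMeasurable f volume := hf ▸ hinv.aestronglyMeasurable.mul h.1
  refine (h.restrict K).of_le_mul (c := C) hfm.restrict
    (ae_restrict_of_forall_mem hK.measurableSet fun x hx => ?_)
  calc ‖f x‖ = ‖(w x)⁻¹‖ * ‖w x * f x‖ := by rw [← norm_mul, congrFun hf x]
    _ ≤ C * ‖w x * f x‖ := mul_le_mul_of_nonneg_right (hC x hx) (norm_nonneg _)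

/-- A weight with `∫_{-∞}^0 μ = ∫_0^∞ μ = ∞`. By continuity this is non-integrability near `±∞`,
which is how it is stated here. -/
structure IsDivergentWeight (μ : ℝ → ℝ) : Prop extends IsWeight μ where
  not_integrableAtFilter_atBot : ¬ IntegrableAtFilter μ atBot volume
  not_integrableAtFilter_atTop : ¬ IntegrableAtFilter μ atTop volume

lemma IsWeight.isDivergentWeight {μ : ℝ → ℝ} (hμ : IsWeight μ)
    (hμ_left : ∫⁻ t in Iic (0 : ℝ), ENNReal.ofReal (μ t) = ∞)
    (hμ_right : ∫⁻ t in Ici (0 : ℝ), ENNReal.ofReal (μ t) = ∞) : IsDivergentWeight μ where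
  toIsWeight := hμ
  not_integrableAtFilter_atBot h := (integrableOn_Iic_iff_integrableAtFilter_atBot.2
    ⟨h, hμ.continuous.locallyIntegrable.locallyIntegrableOn _⟩).lintegral_lt_top.ne hμ_left
  not_integrableAtFilter_atTop h := (integrableOn_Ici_iff_integrableAtFilter_atTop.2
    ⟨h, hμ.continuous.locallyIntegrable.locallyIntegrableOn _⟩).lintegral_lt_top.ne hμ_right

lemma memLp_inv_one_add_abs {r : ℝ≥0∞} (hr : 1 < r) :
    MemLp (fun x : ℝ => (1 + |x|)⁻¹) r volume := by
  have hmeas : AEStronglyMeasurable (fun x : ℝ => (1 + |x|)⁻¹) volume :=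
    (Continuous.inv₀ (by fun_prop) fun x => by positivity).aestronglyMeasurable
  rcases eq_or_ne r ∞ with rfl | hr_top
  · refine memLp_top_of_bound hmeas 1 (.of_forall fun x => ?_)
    rw [Real.norm_of_nonneg (by positivity)]
    exact inv_le_one_of_one_le₀ (by linarith [abs_nonneg x])
  · rw [← integrable_norm_rpow_iff hmeas (zero_lt_one.trans hr).ne' hr_top]
    have hr' : 1 < r.toReal := by
      simpa using (ENNReal.toReal_lt_toReal ENNReal.one_ne_top hr_top).2 hr
    refine (integrable_one_add_norm (E := ℝ) (r := r.toReal) (by simpa using hr')).congr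
      (.of_forall fun x => ?_)
    simp only [Real.norm_eq_abs]
    rw [abs_of_nonneg (by positivity : (0 : ℝ) ≤ (1 + |x|)⁻¹), Real.inv_rpow (by positivity),
      Real.rpow_neg (by positivity)]

lemma integrableAtFilter_of_memLp_mul {p : ℝ≥0∞} (hp : 1 ≤ p) (hp_top : p ≠ ∞) {l : Filter ℝ}
    {μ y : ℝ → ℝ} (hμ : AEStronglyMeasurable μ volume) (hy : Measurable y)
    (hμy : MemLp (fun x => μ x * y x) p volume) {c : ℝ} (hc : 0 < c)
    (hle : ∀ᶠ x in l, c * (1 + |x|) ≤ |y x|) : IntegrableAtFilter μ l volume := by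
  -- Hölder's inequality for `μ = (μ (1 + |x|)) (1 + |x|)⁻¹`.
  set r := ENNReal.conjExponent p
  have hr : 1 < r := ENNReal.lt_add_right ENNReal.one_ne_top
    (ENNReal.inv_ne_zero.2 (ENNReal.sub_ne_top hp_top))
  have : ENNReal.HolderConjugate p r := .conjExponent hp
  refine ⟨{x | c * (1 + |x|) ≤ |y x|}, hle, ?_⟩
  set s := {x | c * (1 + |x|) ≤ |y x|}
  have hs : MeasurableSet s := measurableSet_le (by fun_prop) (by fun_prop)
  have hμx : MemLp (fun x => μ x * (1 + |x|)) p (volume.restrict s) := by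
    refine (hμy.restrict s).of_le_mul (c := c⁻¹)
      (hμ.mul (Continuous.aestronglyMeasurable (by fun_prop))).restrict
      (ae_restrict_of_forall_mem hs fun x hx => ?_)
    rw [norm_mul, norm_mul, mul_left_comm, Real.norm_of_nonneg (by positivity : 0 ≤ 1 + |x|)]
    gcongr
    rwa [le_inv_mul_iff₀ hc]
  have hμ1 : MemLp (fun x => (1 + |x|)⁻¹ * (μ x * (1 + |x|))) 1 (volume.restrict s) :=
    hμx.mul' (p := r) ((memLp_inv_one_add_abs hr).restrict s)
  refine (memLp_one_iff_integrable.1 hμ1).congr (.of_forall fun x => ?_)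
  have : 1 + |x| ≠ 0 := by positivity
  field_simp

namespace IsFSS

variable {q u v f y : ℝ → ℝ} {p : ℝ≥0∞}

lemma exists_eq_comb (h : IsFSS q u v) (hy : IsSolution q (fun _ => 0) y) :
    ∃ a b : ℝ, ∀ x, y x = a * u x + b * v x := by
  refine ⟨deriv v 0 * y 0 - deriv y 0 * v 0, deriv y 0 * u 0 - deriv u 0 * y 0, fun x => ?_⟩
  rw [hy.wronskian_eq h.sol_v 0 x, h.sol_u.wronskian_eq hy 0 x]
  linear_combination (-y x) * h.wronskian x

lemma eq_of_memWeightedLp (h : IsFSS q u v) (hp : 1 ≤ p) (hp_top : p ≠ ∞) {μ : ℝ → ℝ}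
    (hμ : IsDivergentWeight μ) (hy : IsSolution q f y) (hyμ : MemWeightedLp p μ y) {y₀ : ℝ → ℝ}
    (hy₀ : IsSolution q f y₀) {a₀ b₀ : ℝ} (hbot : ∀ᶠ x in atBot, y₀ x = b₀ * v x)
    (htop : ∀ᶠ x in atTop, y₀ x = a₀ * u x) : y = y₀ := by
  have hintegrable : ∀ (l : Filter ℝ) (c : ℝ), 0 < c → (∀ᶠ x in l, c * (1 + |x|) ≤ |y x|) →
      IntegrableAtFilter μ l volume := fun l c =>
    integrableAtFilter_of_memLp_mul hp hp_top hμ.continuous.aestronglyMeasurable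
      hy.continuous.measurable ((hμ.memWeightedLp_iff hp).1 hyμ)
  obtain ⟨a, b, hab⟩ := h.exists_eq_comb (hy.sub hy₀)
  have ha : a = 0 := by
    by_contra ha
    obtain ⟨c, hc, hle⟩ := h.isMonotonePair.exists_eventually_atBot_le_abs ha (b + b₀)
    refine hμ.not_integrableAtFilter_atBot (hintegrable _ c hc ?_)
    filter_upwards [hle, hbot] with x hx hx₀
    rwa [show y x = a * u x + (b + b₀) * v x by linarith [hab x]]
  have hb : b = 0 := by
    by_contra hb
    obtain ⟨c, hc, hle⟩ := h.isMonotonePair.exists_eventually_atTop_le_abs (a + a₀) hb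
    refine hμ.not_integrableAtFilter_atTop (hintegrable _ c hc ?_)
    filter_upwards [hle, htop] with x hx hx₀
    rwa [show y x = (a + a₀) * u x + b * v x by linarith [hab x]]
  ext x
  simpa [ha, hb, sub_eq_zero] using hab x

lemma eq_of_isSolution (h : IsFSS q u v) (hp : 1 ≤ p) (hp_top : p ≠ ∞) {μ : ℝ → ℝ}
    (hμ : IsDivergentWeight μ) {y₁ y₂ : ℝ → ℝ} (h₁ : IsSolution q f y₁) (h₂ : IsSolution q f y₂)
    (hy₁ : MemWeightedLp p μ y₁) (hy₂ : MemWeightedLp p μ y₂) : y₁ = y₂ := by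
  have hmem : MemWeightedLp p μ (fun x => y₁ x - y₂ x) := by
    rw [hμ.memWeightedLp_iff hp] at hy₁ hy₂ ⊢
    simp only [mul_sub]
    exact hy₁.sub hy₂
  have hzero : IsSolution q (fun _ => 0) (fun _ => 0) := by
    simpa using h.sol_u.comb_zero h.sol_v 0 0
  have := h.eq_of_memWeightedLp hp hp_top hμ (h₁.sub h₂) hmem hzero (a₀ := 0) (b₀ := 0)
    (by simp) (by simp)
  exact funext fun x => sub_eq_zero.1 (congrFun this x)

end IsFSS

/-- The solution `∫ G(x,t) f(t) dt` of `-y'' + q y = f` given by the Green function. As a Bochner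
integral it is zero where the integrand is not integrable. -/
def greenPotential (u v f : ℝ → ℝ) (x : ℝ) : ℝ :=
  ∫ t, green u v x t * f t

/-- The extended nonnegative potential `∫ |G(x,t) f(t)| dt`, which is finite exactly where the
integral defining `greenPotential` converges absolutely. -/
def lgreenPotential (u v f : ℝ → ℝ) (x : ℝ) : ℝ≥0∞ :=
  ∫⁻ t, ‖green u v x t * f t‖ₑ

section Green

variable {u v f : ℝ → ℝ}

lemma green_nonneg (hu : ∀ x, 0 < u x) (hv : ∀ x, 0 < v x) (x t : ℝ) : 0 ≤ green u v x t := by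
  unfold green
  split_ifs
  · exact (mul_pos (hu x) (hv t)).le
  · exact (mul_pos (hu t) (hv x)).le

lemma measurable_green (hu : Measurable u) (hv : Measurable v) (x : ℝ) :
    Measurable (green u v x) :=
  Measurable.ite measurableSet_Iic (hv.const_mul _) (hu.mul_const _)

lemma green_mul_of_le {x t : ℝ} (h : t ≤ x) : green u v x t * f t = u x * (v t * f t) := by
  rw [green, if_pos h, mul_assoc]

lemma green_mul_of_ge {x t : ℝ} (h : x ≤ t) : green u v x t * f t = v x * (u t * f t) := by
  rcases h.eq_or_lt with rfl | h
  · rw [green_mul_of_le le_rfl, mul_left_comm]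
  · rw [green, if_neg h.not_ge, mul_assoc, mul_left_comm]

lemma integrable_green_mul_iff (hu : ∀ x, 0 < u x) (hv : ∀ x, 0 < v x) (x : ℝ) :
    Integrable (fun t => green u v x t * f t) ↔
      IntegrableOn (fun t => v t * f t) (Iic x) ∧ IntegrableOn (fun t => u t * f t) (Ioi x) := by
  rw [← integrableOn_univ, ← Iic_union_Ioi (a := x), integrableOn_union]
  refine and_congr ?_ ?_
  · exact (integrableOn_congr_fun (fun t ht => green_mul_of_le ht) measurableSet_Iic).trans
      (integrable_const_mul_iff (hu x).ne'.isUnit _)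
  · exact (integrableOn_congr_fun (fun t ht => green_mul_of_ge (le_of_lt ht))
      measurableSet_Ioi).trans (integrable_const_mul_iff (hv x).ne'.isUnit _)

lemma greenPotential_eq {x : ℝ} (h : Integrable (fun t => green u v x t * f t)) :
    greenPotential u v f x =
      u x * (∫ t in Iic x, v t * f t) + v x * ∫ t in Ioi x, u t * f t := by
  rw [greenPotential,
    ← intervalIntegral.integral_Iic_add_Ioi h.integrableOn h.integrableOn (b := x),
    ← integral_const_mul, ← integral_const_mul,
    setIntegral_congr_fun measurableSet_Iic fun t ht => green_mul_of_le ht,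
    setIntegral_congr_fun measurableSet_Ioi fun t ht => green_mul_of_ge (le_of_lt ht)]

lemma greenPotential_of_forall_gt {x : ℝ} (hf : ∀ t, x < t → f t = 0) :
    greenPotential u v f x = (∫ t, v t * f t) * u x := by
  rw [mul_comm, ← integral_const_mul]
  refine integral_congr_ae (.of_forall fun t => ?_)
  rcases le_or_gt t x with ht | ht
  · exact green_mul_of_le ht
  · simp only [hf t ht, mul_zero]

lemma greenPotential_of_forall_lt {x : ℝ} (hf : ∀ t, t < x → f t = 0) :
    greenPotential u v f x = (∫ t, u t * f t) * v x := by
  rw [mul_comm, ← integral_const_mul]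
  refine integral_congr_ae (.of_forall fun t => ?_)
  rcases le_or_gt x t with ht | ht
  · exact green_mul_of_ge ht
  · simp only [hf t ht, mul_zero]

lemma eventually_atTop_greenPotential_eq (hf : HasCompactSupport f) :
    ∀ᶠ x in atTop, greenPotential u v f x = (∫ t, v t * f t) * u x := by
  have hf₀ : ∀ᶠ t in atTop, f t = 0 :=
    atTop_le_cocompact (coclosedCompact_eq_cocompact (X := ℝ) ▸
      hasCompactSupport_iff_eventuallyEq.1 hf)
  filter_upwards [eventually_forall_ge_atTop.2 hf₀] with x hx
  exact greenPotential_of_forall_gt fun t ht => hx t ht.le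

lemma eventually_atBot_greenPotential_eq (hf : HasCompactSupport f) :
    ∀ᶠ x in atBot, greenPotential u v f x = (∫ t, u t * f t) * v x := by
  have hf₀ : ∀ᶠ t in atBot, f t = 0 :=
    atBot_le_cocompact (coclosedCompact_eq_cocompact (X := ℝ) ▸
      hasCompactSupport_iff_eventuallyEq.1 hf)
  filter_upwards [eventually_forall_le_atBot.2 hf₀] with x hx
  exact greenPotential_of_forall_lt fun t ht => hx t ht.le

lemma enorm_greenPotential_le (x : ℝ) : ‖greenPotential u v f x‖ₑ ≤ lgreenPotential u v f x :=
  enorm_integral_le_lintegral_enorm _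

lemma enorm_greenPotential (hu : ∀ x, 0 < u x) (hv : ∀ x, 0 < v x) (hf : ∀ t, 0 ≤ f t) {x : ℝ}
    (hint : Integrable (fun t => green u v x t * f t)) :
    ‖greenPotential u v f x‖ₑ = lgreenPotential u v f x := by
  have hnn : ∀ t, 0 ≤ green u v x t * f t := fun t => mul_nonneg (green_nonneg hu hv x t) (hf t)
  rw [lgreenPotential, ← ofReal_integral_norm_eq_lintegral_enorm hint]
  simp only [Real.norm_of_nonneg (hnn _)]
  exact Real.enorm_of_nonneg (integral_nonneg hnn)

lemma lgreenPotential_indicator_abs {s : Set ℝ} (hs : MeasurableSet s) (x : ℝ) :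
    lgreenPotential u v (s.indicator fun t => |f t|) x = ∫⁻ t in s, ‖green u v x t * f t‖ₑ := by
  rw [← lintegral_indicator hs]
  refine lintegral_congr fun t => ?_
  by_cases ht : t ∈ s <;> simp [ht, enorm_mul]

lemma tendsto_lgreenPotential_indicator_abs (hu : Measurable u) (hv : Measurable v)
    (hf : AEStronglyMeasurable f volume) (x : ℝ) :
    Tendsto (fun n : ℕ => lgreenPotential u v ((Icc (-n : ℝ) n).indicator fun t => |f t|) x) atTop
      (𝓝 (lgreenPotential u v f x)) := by
  simp only [lgreenPotential_indicator_abs measurableSet_Icc]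
  have hcover : AECover (volume : Measure ℝ) atTop fun n : ℕ => Icc (-n : ℝ) n :=
    aecover_Icc (tendsto_neg_atTop_atBot.comp tendsto_natCast_atTop_atTop)
      tendsto_natCast_atTop_atTop
  exact hcover.lintegral_tendsto_of_countably_generated
    ((measurable_green hu hv x).aestronglyMeasurable.mul hf).enorm

end Green

lemma MemWeightedLp.mono {p : ℝ≥0∞} {w f g : ℝ → ℝ} (hf : MemWeightedLp p w f)
    (hg : AEStronglyMeasurable g volume) (hgf : ∀ x, |g x| ≤ |f x|) :
    MemWeightedLp p w g ∧ weightedNorm p w g ≤ weightedNorm p w f := by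
  have hle : weightedNorm p w g ≤ weightedNorm p w f := eLpNorm_mono fun x => by
    rw [norm_mul, norm_mul]
    exact mul_le_mul_of_nonneg_left (hgf x) (norm_nonneg _)
  exact ⟨⟨fun K hK => (hf.1 K hK).mono hg.restrict (.of_forall hgf), hle.trans_lt hf.2⟩, hle⟩

lemma eLpNorm_le_of_tendsto {α : Type*} [MeasurableSpace α] {ν : Measure α} {p M : ℝ≥0∞}
    (hp : p ≠ 0) (hp_top : p ≠ ∞) {F : ℕ → α → ℝ≥0∞} {G : α → ℝ≥0∞}
    (hF : ∀ n, AEMeasurable (F n) ν) (hM : ∀ n, eLpNorm (F n) p ν ≤ M)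
    (hlim : ∀ᵐ x ∂ν, Tendsto (fun n => F n x) atTop (𝓝 (G x))) : eLpNorm G p ν ≤ M := by
  have hpr : 0 < p.toReal := ENNReal.toReal_pos hp hp_top
  simp only [eLpNorm_eq_lintegral_rpow_enorm_toReal hp hp_top, one_div,
    ENNReal.rpow_inv_le_iff hpr, enorm_eq_self] at hM ⊢
  calc ∫⁻ x, G x ^ p.toReal ∂ν = ∫⁻ x, liminf (fun n => F n x ^ p.toReal) atTop ∂ν :=
        lintegral_congr_ae (hlim.mono fun x hx => (hx.ennrpow_const _).liminf_eq.symm)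
    _ ≤ liminf (fun n => ∫⁻ x, F n x ^ p.toReal ∂ν) atTop :=
        lintegral_liminf_le' fun n => (hF n).pow_const _
    _ ≤ M ^ p.toReal := liminf_le_of_frequently_le' (.of_forall hM)

lemma boundedS_iff {p : ℝ≥0∞} (hp : 1 ≤ p) {u v μ θ : ℝ → ℝ} (hμ : IsWeight μ) (hθ : IsWeight θ) :
    BoundedS p u v μ θ ↔ ∃ C : ℝ≥0, ∀ f, MemWeightedLp p θ f →
      (∀ᵐ x : ℝ, Integrable (fun t => green u v x t * f t)) ∧
      MemWeightedLp p μ (greenPotential u v f) ∧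
      weightedNorm p μ (greenPotential u v f) ≤ C * weightedNorm p θ f := by
  have hcancel : ∀ f : ℝ → ℝ, ∀ x t, green u v x t / θ t * (θ t * f t) = green u v x t * f t :=
    fun f x t => by rw [← mul_assoc, div_mul_cancel₀ _ (hθ.pos t).ne']
  have hop : ∀ f : ℝ → ℝ, opS u v μ θ (fun t => θ t * f t) =
      fun x => μ x * greenPotential u v f x :=
    fun f => funext fun x => by simp only [opS, hcancel, greenPotential]
  refine exists_congr fun C => ⟨fun h f hf => ?_, fun h f hf => ?_⟩
  · rw [hθ.memWeightedLp_iff hp] at hf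
    simpa only [hcancel, hop, ← hμ.memWeightedLp_iff hp, weightedNorm] using h _ hf
  · obtain ⟨g, rfl⟩ : ∃ g : ℝ → ℝ, (fun t => θ t * g t) = f :=
      ⟨fun t => f t / θ t, funext fun t => mul_div_cancel₀ _ (hθ.pos t).ne'⟩
    simpa only [hcancel, hop, hμ.memWeightedLp_iff hp, weightedNorm] using
      h g ((hθ.memWeightedLp_iff hp).2 hf)

namespace IsFSS

variable {q u v f : ℝ → ℝ}

lemma locallyIntegrable_u_mul (h : IsFSS q u v) (hf : LocallyIntegrable f volume) :
    LocallyIntegrable (fun t => u t * f t) volume := by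
  simpa only [mul_comm] using hf.mul_continuous h.sol_u.continuous

lemma locallyIntegrable_v_mul (h : IsFSS q u v) (hf : LocallyIntegrable f volume) :
    LocallyIntegrable (fun t => v t * f t) volume := by
  simpa only [mul_comm] using hf.mul_continuous h.sol_v.continuous

lemma integrable_green_mul (h : IsFSS q u v) (hf : LocallyIntegrable f volume) {x₀ : ℝ}
    (hx₀ : Integrable (fun t => green u v x₀ t * f t)) (x : ℝ) :
    Integrable (fun t => green u v x t * f t) := by
  rw [integrable_green_mul_iff h.pos_u h.pos_v] at hx₀ ⊢
  constructor
  · refine (hx₀.1.union ((h.locallyIntegrable_v_mul hf).integrableOn_isCompact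
      (isCompact_Icc (a := x₀) (b := x)))).mono_set fun t ht => ?_
    exact (le_total t x₀).imp id fun h => ⟨h, ht⟩
  · refine (hx₀.2.union ((h.locallyIntegrable_u_mul hf).integrableOn_isCompact
      (isCompact_Icc (a := x) (b := x₀)))).mono_set fun t ht => ?_
    exact (lt_or_ge x₀ t).imp id fun h => ⟨le_of_lt ht, h⟩

lemma integrable_green_mul_of_hasCompactSupport (h : IsFSS q u v)
    (hf : LocallyIntegrable f volume) (hfc : HasCompactSupport f) (x : ℝ) :
    Integrable (fun t => green u v x t * f t) := by
  have hmul : ∀ k : ℝ → ℝ, LocallyIntegrable (fun t => k t * f t) volume →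
      Integrable (fun t => k t * f t) := fun k hk =>
    (integrableOn_iff_integrable_of_support_subset
      ((Function.support_mul_subset_right k f).trans (subset_tsupport f))).1
      (hk.integrableOn_isCompact hfc)
  rw [integrable_green_mul_iff h.pos_u h.pos_v]
  exact ⟨(hmul v (h.locallyIntegrable_v_mul hf)).integrableOn,
    (hmul u (h.locallyIntegrable_u_mul hf)).integrableOn⟩

lemma isSolution_greenPotential (h : IsFSS q u v) (hf : LocallyIntegrable f volume)
    (hint : ∀ x, Integrable (fun t => green u v x t * f t)) :
    IsSolution q f (greenPotential u v f) := by
  have hv := fun x => ((integrable_green_mul_iff h.pos_u h.pos_v x).1 (hint x)).1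
  have hu := fun x => ((integrable_green_mul_iff h.pos_u h.pos_v x).1 (hint x)).2
  set F : ℝ → ℝ := fun x => ∫ t in Iic x, v t * f t
  set H : ℝ → ℝ := fun x => ∫ t in Ioi x, u t * f t
  have hF : IsPrimitive F (fun t => v t * f t) :=
    ⟨h.locallyIntegrable_v_mul hf, fun a b => intervalIntegral.integral_Iic_sub_Iic (hv a) (hv b)⟩
  have hH : IsPrimitive H (fun t => -1 * (u t * f t)) := by
    refine ⟨(h.locallyIntegrable_u_mul hf).smul (-1 : ℝ), fun a b => ?_⟩
    rw [intervalIntegral.integral_const_mul]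
    linarith [intervalIntegral.integral_interval_add_Ioi (hu a) (hu b)]
  -- The terms with `F'` and `H'` cancel in the derivative of `u F + v H`, and leave `-f` in the
  -- derivative of `u' F + v' H` by the Wronskian identity.
  have hy := (h.sol_u.isPrimitive.mul hF).add (h.sol_v.isPrimitive.mul hH)
  have hz := (h.sol_u.isPrimitive_deriv.mul hF).add (h.sol_v.isPrimitive_deriv.mul hH)
  rw [show greenPotential u v f = fun x => u x * F x + v x * H x from
    funext fun x => greenPotential_eq (hint x)]
  refine IsSolution.of_hasDerivAt (z := fun x => deriv u x * F x + deriv v x * H x)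
    ((hy.congr fun x => ?_).hasDerivAt hz.continuous) (hz.congr fun x => ?_)
  · ring
  · linear_combination (-f x) * h.wronskian x

end IsFSS

namespace IsFSS

variable {q u v f μ θ : ℝ → ℝ} {p : ℝ≥0∞}

lemma eq_greenPotential_of_hasCompactSupport (h : IsFSS q u v) (hp : 1 ≤ p) (hp_top : p ≠ ∞)
    (hμ : IsDivergentWeight μ) (hf : LocallyIntegrable f volume) (hfc : HasCompactSupport f)
    {y : ℝ → ℝ} (hy : IsSolution q f y) (hyμ : MemWeightedLp p μ y) : y = greenPotential u v f :=
  h.eq_of_memWeightedLp hp hp_top hμ hy hyμ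
    (h.isSolution_greenPotential hf (h.integrable_green_mul_of_hasCompactSupport hf hfc))
    (eventually_atBot_greenPotential_eq hfc) (eventually_atTop_greenPotential_eq hfc)

lemma admissible_iff (h : IsFSS q u v) (hp : 1 ≤ p) (hp_top : p ≠ ∞) (hμ : IsDivergentWeight μ) :
    Admissible p q μ θ ↔ ∃ C : ℝ≥0, ∀ f, MemWeightedLp p θ f → ∃ y, IsSolution q f y ∧
      MemWeightedLp p μ y ∧ weightedNorm p μ y ≤ C * weightedNorm p θ f := by
  constructor
  · rintro ⟨hex, c, -, hc⟩
    refine ⟨c, fun f hf => ?_⟩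
    obtain ⟨y, ⟨hy, hyμ⟩, -⟩ := hex f hf
    exact ⟨y, hy, hyμ, hc f hf y hy hyμ⟩
  · rintro ⟨C, hC⟩
    refine ⟨fun f hf => ?_, C + 1, by positivity, fun f hf y hy hyμ => ?_⟩
    · obtain ⟨y, hy, hyμ, -⟩ := hC f hf
      exact ⟨y, ⟨hy, hyμ⟩, fun z hz => h.eq_of_isSolution hp hp_top hμ hz.1 hy hz.2 hyμ⟩
    · obtain ⟨z, hz, hzμ, hle⟩ := hC f hf
      rw [h.eq_of_isSolution hp hp_top hμ hy hz hyμ hzμ]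
      refine hle.trans ?_
      gcongr
      exact le_self_add

lemma eLpNorm_mul_lgreenPotential_le (h : IsFSS q u v) (hp : 1 ≤ p) (hp_top : p ≠ ∞)
    (hμ : IsDivergentWeight μ) {C : ℝ≥0}
    (hC : ∀ f, MemWeightedLp p θ f → ∃ y, IsSolution q f y ∧ MemWeightedLp p μ y ∧
      weightedNorm p μ y ≤ C * weightedNorm p θ f) (hf : MemWeightedLp p θ f) :
    eLpNorm (fun x => ‖μ x‖ₑ * lgreenPotential u v f x) p volume ≤ C * weightedNorm p θ f := by
  have hfm : AEStronglyMeasurable f volume := (hf.1.locallyIntegrable hp).aestronglyMeasurable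
  set g : ℕ → ℝ → ℝ := fun n => (Icc (-n : ℝ) n).indicator fun t => |f t|
  have hg : ∀ n, MemWeightedLp p θ (g n) ∧ weightedNorm p θ (g n) ≤ weightedNorm p θ f :=
    fun n => hf.mono (hfm.norm.indicator measurableSet_Icc) fun t => by
      simpa using norm_indicator_le_norm_self (fun t => |f t|) t
  have hgc : ∀ n, HasCompactSupport (g n) := fun n =>
    .intro isCompact_Icc fun t ht => indicator_of_notMem ht _
  have hg_loc : ∀ n, LocallyIntegrable (g n) volume := fun n => (hg n).1.1.locallyIntegrable hp
  have hint := fun n => h.integrable_green_mul_of_hasCompactSupport (hg_loc n) (hgc n)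
  have hpot : ∀ n x, ‖μ x‖ₑ * lgreenPotential u v (g n) x = ‖μ x * greenPotential u v (g n) x‖ₑ :=
    fun n x => by
      rw [enorm_mul, enorm_greenPotential h.pos_u h.pos_v
        (indicator_nonneg fun t _ => abs_nonneg (f t)) (hint n x)]
  refine eLpNorm_le_of_tendsto (F := fun n x => ‖μ x‖ₑ * lgreenPotential u v (g n) x)
    (zero_lt_one.trans_le hp).ne' hp_top (fun n => ?_) (fun n => ?_) (.of_forall fun x =>
      ENNReal.Tendsto.const_mul (tendsto_lgreenPotential_indicator_abs
        h.sol_u.continuous.measurable h.sol_v.continuous.measurable hfm x) (.inr enorm_ne_top))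
  · simp only [hpot]
    exact (hμ.continuous.mul
      (h.isSolution_greenPotential (hg_loc n) (hint n)).continuous).measurable.enorm.aemeasurable
  · obtain ⟨y, hy, hyμ, hle⟩ := hC _ (hg n).1
    rw [h.eq_greenPotential_of_hasCompactSupport hp hp_top hμ (hg_loc n) (hgc n) hy hyμ] at hle
    simp only [hpot, eLpNorm_enorm]
    exact hle.trans (mul_le_mul_right (hg n).2 _)

lemma integrable_green_mul_of_eLpNorm_lt_top (h : IsFSS q u v) (hp : p ≠ 0)
    (hμ : ∀ x, μ x ≠ 0) (hf : LocallyIntegrable f volume)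
    (hfin : eLpNorm (fun x => ‖μ x‖ₑ * lgreenPotential u v f x) p volume < ∞) (x : ℝ) :
    Integrable (fun t => green u v x t * f t) := by
  obtain ⟨x₀, hx₀⟩ : ∃ x₀, lgreenPotential u v f x₀ ≠ ∞ := by
    by_contra! htop
    refine hfin.ne ?_
    simp only [htop, ENNReal.mul_top (enorm_ne_zero.2 (hμ _))]
    rw [eLpNorm_const _ hp NeZero.out, enorm_eq_self, Real.volume_univ, ENNReal.top_mul]
    simp
  exact h.integrable_green_mul hf ⟨(measurable_green h.sol_u.continuous.measurable
    h.sol_v.continuous.measurable x₀).aestronglyMeasurable.mul hf.aestronglyMeasurable,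
    lt_top_iff_ne_top.2 hx₀⟩ x

theorem admissible_iff_boundedS (h : IsFSS q u v) (hp : 1 ≤ p) (hp_top : p ≠ ∞)
    (hμ : IsDivergentWeight μ) (hθ : IsWeight θ) : Admissible p q μ θ ↔ BoundedS p u v μ θ := by
  rw [h.admissible_iff hp hp_top hμ, boundedS_iff hp hμ.toIsWeight hθ]
  refine exists_congr fun C => ⟨fun hC f hf => ?_, fun hC f hf => ?_⟩
  · have hloc := hf.1.locallyIntegrable hp
    have hle := h.eLpNorm_mul_lgreenPotential_le hp hp_top hμ hC hf
    have hint := h.integrable_green_mul_of_eLpNorm_lt_top (zero_lt_one.trans_le hp).ne'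
      (fun x => (hμ.pos x).ne') hloc
      (hle.trans_lt (ENNReal.mul_lt_top ENNReal.coe_lt_top hf.2))
    have hbound : weightedNorm p μ (greenPotential u v f) ≤ C * weightedNorm p θ f :=
      (eLpNorm_mono_enorm fun x => by
        rw [enorm_mul, enorm_eq_self]
        gcongr
        exact enorm_greenPotential_le x).trans hle
    refine ⟨.of_forall hint, (hμ.memWeightedLp_iff hp).2 ⟨?_, ?_⟩, hbound⟩
    · exact (hμ.continuous.mul
        (h.isSolution_greenPotential hloc hint).continuous).aestronglyMeasurable
    · exact hbound.trans_lt (ENNReal.mul_lt_top ENNReal.coe_lt_top hf.2)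
  · obtain ⟨hint, hmem, hle⟩ := hC f hf
    obtain ⟨x₀, hx₀⟩ := hint.exists
    have hloc := hf.1.locallyIntegrable hp
    exact ⟨_, h.isSolution_greenPotential hloc (h.integrable_green_mul hloc hx₀), hmem, hle⟩

end IsFSS

end SturmLiouville

end

theorem theorem4p3 (p : ℝ≥0∞) (hp : 1 ≤ p) (hp_top : p ≠ ∞)
    (q μ θ : ℝ → ℝ)
    (hq_nonneg : ∀ᵐ x : ℝ, 0 ≤ q x) (hq_loc : LocallyIntegrable q volume)
    (hq_left : ∀ x : ℝ, 0 < ∫⁻ t in Iic x, ENNReal.ofReal (q t))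
    (hq_right : ∀ x : ℝ, 0 < ∫⁻ t in Ici x, ENNReal.ofReal (q t))
    (hμ_cont : Continuous μ) (hμ_pos : ∀ x, 0 < μ x)
    (hθ_cont : Continuous θ) (hθ_pos : ∀ x, 0 < θ x)
    (hμ_left : ∫⁻ t in Iic (0 : ℝ), ENNReal.ofReal (μ t) = ∞)
    (hμ_right : ∫⁻ t in Ici (0 : ℝ), ENNReal.ofReal (μ t) = ∞) :
    (∃ u v : ℝ → ℝ, SturmLiouville.IsFSS q u v) ∧
    ∀ u v : ℝ → ℝ, SturmLiouville.IsFSS q u v →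
      (SturmLiouville.Admissible p q μ θ ↔ SturmLiouville.BoundedS p u v μ θ) :=
  ⟨SturmLiouville.exists_isFSS hq_loc hq_nonneg hq_left hq_right, fun _ _ h =>
    h.admissible_iff_boundedS hp hp_top
      (SturmLiouville.IsWeight.isDivergentWeight ⟨hμ_cont, hμ_pos⟩ hμ_left hμ_right)
      ⟨hθ_cont, hθ_pos⟩⟩
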